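/- Let $G$ be a compact Hausdorff topological group, let $\mathrm{Aut}(G)$ be the group of all topological automorphisms of $G$ with the compact-open topology, and let $\mathrm{Inn}(G)\le \mathrm{Aut}(G)$ be the subgroup of inner automorphisms. Let $P$ be a (not necessarily closed) subgroup of $\mathrm{Aut}(G)$, with closure $\overline P$ in $\mathrm{Aut}(G)$, and let $G\rtimes P$ be the semidirect product for the natural action of $P$ on $G$, with the product topology, where $P$ carries the subspace topology. A Hausdorff topological group is called minimal if it admits no strictly coarser Hausdorff group topology. A subgroup $H$ of a topological group $A$ is called essential in $A$ if $H\cap N$ is nontrivial for every nontrivial closed normal subgroup $N$ of $A$. Then $G\rtimes P$ is a minimal topological group in each of the following cases: 1. $G$ is abelian; 2. $P$ is essential in $\overline P$ (in particular, whenever $P$ is closed in $\mathrm{Aut}(G)$, since then $P$ is essential in $\overline P$); 3. $P\cap \mathrm{Inn}(G)$ is essential in $\overline P\cap \mathrm{Inn}(G)$. -/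

import Mathlib

namespace MinimalSemidirect

/-- `Aut(G)`: the group (under composition) of all topological automorphisms of `G`. -/
instance autGroup {G : Type*} [Group G] [TopologicalSpace G] : Group (G ≃ₜ* G) where
  mul f g := g.trans f
  one := ContinuousMulEquiv.refl G
  inv f := f.symm
  mul_assoc _ _ _ := rfl
  one_mul _ := rfl
  mul_one _ := rfl
  inv_mul_cancel f := f.self_trans_symm

/-- An automorphism, viewed as a continuous self-map. -/
def autToMap (G : Type*) [Group G] [TopologicalSpace G] (f : G ≃ₜ* G) : C(G, G) :=
  ⟨f, f.continuous_toFun⟩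

/-- The compact-open topology on `Aut(G)`. -/
instance autTopology {G : Type*} [Group G] [TopologicalSpace G] : TopologicalSpace (G ≃ₜ* G) :=
  TopologicalSpace.induced (autToMap G) ContinuousMap.compactOpen

/-- For compact Hausdorff `G`, `Aut(G)` with the compact-open topology is a topological group. -/
instance autIsTopologicalGroup {G : Type*} [Group G] [TopologicalSpace G]
    [CompactSpace G] [T2Space G] : IsTopologicalGroup (G ≃ₜ* G) where
  continuous_mul := by
    have h : Continuous (autToMap G) := continuous_induced_dom
    refine continuous_induced_rng.2 ?_
    exact (h.comp continuous_fst).compCM (h.comp continuous_snd)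
  continuous_inv := by
    refine continuous_induced_rng.2 ?_
    refine ContinuousMap.continuous_compactOpen.2 fun K hK U hU => ?_
    have h : Continuous (autToMap G) := continuous_induced_dom
    have ho := (ContinuousMap.isOpen_setOfPred_mapsTo (X := G) (Y := G)
      hU.isClosed_compl.isCompact hK.isClosed.isOpen_compl).preimage h
    convert ho using 1
    ext f
    constructor
    · intro hf x hx hxK
      apply hx
      have := hf hxK
      change f.symm (f x) ∈ U at this
      rwa [f.symm_apply_apply] at this
    · intro hf y hy
      by_contra hn
      have := hf hn
      apply this
      change f (f.symm y) ∈ K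
      rwa [f.apply_symm_apply]

/-- Conjugation `g ↦ (x ↦ g * x * g⁻¹)` as a homomorphism from `G` to `Aut(G)`. -/
def conjHom (G : Type*) [Group G] [TopologicalSpace G] [IsTopologicalGroup G] :
    G →* (G ≃ₜ* G) where
  toFun g :=
    { MulAut.conj g with
      continuous_toFun := by
        change Continuous fun x : G => g * x * g⁻¹
        fun_prop
      continuous_invFun := by
        change Continuous fun x : G => g⁻¹ * x * g
        fun_prop }
  map_one' := by
    ext x
    change 1 * x * (1 : G)⁻¹ = x
    simp
  map_mul' a b := by
    ext x
    change a * b * x * (a * b)⁻¹ = a * (b * x * b⁻¹) * a⁻¹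
    simp [mul_assoc]

/-- `Inn(G)`: the subgroup of inner automorphisms. -/
def Inn (G : Type*) [Group G] [TopologicalSpace G] [IsTopologicalGroup G] : Subgroup (G ≃ₜ* G) :=
  (conjHom G).range

/-- The natural action of a subgroup `P ≤ Aut(G)` on `G`, by `f • x = f x`. -/
def autAction {G : Type*} [Group G] [TopologicalSpace G] (P : Subgroup (G ≃ₜ* G)) :
    P →* MulAut G where
  toFun f := (f : G ≃ₜ* G).toMulEquiv
  map_one' := rfl
  map_mul' _ _ := rfl

/-- The product topology on a semidirect product. -/
instance semidirectTopology {N H : Type*} [Group N] [Group H] [TopologicalSpace N]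
    [TopologicalSpace H] (φ : H →* MulAut N) : TopologicalSpace (N ⋊[φ] H) :=
  TopologicalSpace.induced (fun x => (x.left, x.right)) instTopologicalSpaceProd

/-- `M` is a minimal topological group: a Hausdorff topological group all of whose coarser
Hausdorff group topologies agree with the given one. (In the order on topologies used here,
`t₀ ≤ t` says that `t` is coarser than `t₀`.) -/
structure IsMinimalGroup (M : Type*) [Group M] [t₀ : TopologicalSpace M] : Prop where
  isTopologicalGroup : IsTopologicalGroup M
  t2Space : T2Space M
  eq_of_coarser : ∀ t : TopologicalSpace M,
    @IsTopologicalGroup M t _ → @T2Space M t → t₀ ≤ t → t = t₀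

/-- A subgroup `H` of a topological group `A` is essential in `A` if it meets every nontrivial
closed normal subgroup of `A` nontrivially. -/
def IsEssential {A : Type*} [Group A] [TopologicalSpace A] (H : Subgroup A) : Prop :=
  ∀ N : Subgroup A, N.Normal → IsClosed (N : Set A) → N ≠ ⊥ → H ⊓ N ≠ ⊥

end MinimalSemidirect

open Filter Topology

namespace MinimalSemidirect

/-! ### Continuity in the automorphism group. -/

section Aut

variable {G : Type*} [Group G] [TopologicalSpace G]

/-! Let `K` be `G ⋊ P` with a coarser Hausdorff group topology. The compact group `G` keeps its
topology inside `K`, so `K` acts on `G` continuously by conjugation. Only the topology on the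
`P`-coordinate can change, and the obstruction is the set `L` of elements of `G` that are limits in
`K` of elements of `P` (`limitSubgroup`). If `L` acts trivially on `G`, compactness of `G` makes
both coordinates continuous on `K` (`continuous_symm_of_conjHom_eq_one`). For abelian `G` this is
automatic. In general `L` maps onto a compact subgroup of inner automorphisms in the closure of `P`,
normalized by that closure and meeting `P` trivially (`eq_one_of_mem_limitSubgroup`); essentiality
forces it to be trivial. -/

lemma autToMap_injective : Function.Injective (autToMap G) := by
  intro f g h
  ext x
  exact congrArg (fun k : C(G, G) => k x) h

instance autT2Space [T2Space G] : T2Space (G ≃ₜ* G) :=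
  T2Space.of_injective_continuous autToMap_injective continuous_induced_dom

lemma aut_mul_apply (f g : G ≃ₜ* G) (x : G) : (f * g) x = f (g x) := rfl

lemma aut_apply_inv_self (f : G ≃ₜ* G) (x : G) : f (f⁻¹ x) = x := f.apply_symm_apply x

/-- A family of automorphisms that is jointly continuous is continuous for the compact-open
topology. -/
lemma continuous_aut_of_uncurry {X : Type*} [TopologicalSpace X] {F : X → (G ≃ₜ* G)}
    (hF : Continuous fun p : X × G => F p.1 p.2) : Continuous F :=
  continuous_induced_rng.2 (ContinuousMap.continuous_of_continuous_uncurry _ hF)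

/-- Evaluation of automorphisms of a compact Hausdorff group is jointly continuous. -/
lemma continuous_aut_eval [CompactSpace G] [T2Space G] :
    Continuous fun p : (G ≃ₜ* G) × G => p.1 p.2 := by
  have h : Continuous (autToMap G) := continuous_induced_dom
  have h' : Continuous fun p : (G ≃ₜ* G) × G => autToMap G p.1 p.2 :=
    (h.comp continuous_fst).eval continuous_snd
  exact h'

variable [IsTopologicalGroup G]

lemma conjHom_apply (g x : G) : conjHom G g x = g * x * g⁻¹ := rfl

lemma continuous_conjHom : Continuous (conjHom G) := by
  apply continuous_aut_of_uncurry
  change Continuous fun p : G × G => p.1 * p.2 * p.1⁻¹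
  fun_prop

lemma aut_mul_conjHom_mul_inv (f : G ≃ₜ* G) (g : G) :
    f * conjHom G g * f⁻¹ = conjHom G (f g) := by
  ext x
  simp only [aut_mul_apply, conjHom_apply, map_mul, map_inv, aut_apply_inv_self]

end Aut

/-! ### The semidirect product as a topological group. -/

section Semidirect

variable {G : Type*} [Group G] [TopologicalSpace G] (P : Subgroup (G ≃ₜ* G))

lemma continuous_toProd : Continuous fun m : G ⋊[autAction P] P => (m.left, m.right) :=
  continuous_induced_dom

lemma continuous_left : Continuous fun m : G ⋊[autAction P] P => m.left :=
  continuous_fst.comp (continuous_toProd P)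

lemma continuous_right : Continuous fun m : G ⋊[autAction P] P => m.right :=
  continuous_snd.comp (continuous_toProd P)

lemma continuous_semidirect_rng {X : Type*} [TopologicalSpace X] {f : X → G ⋊[autAction P] P}
    (hl : Continuous fun x => (f x).left) (hr : Continuous fun x => (f x).right) :
    Continuous f :=
  continuous_induced_rng.2 (hl.prodMk hr)

lemma continuous_inl : Continuous (SemidirectProduct.inl : G →* G ⋊[autAction P] P) :=
  continuous_semidirect_rng P continuous_id continuous_const

lemma continuous_inr : Continuous (SemidirectProduct.inr : P →* G ⋊[autAction P] P) :=
  continuous_semidirect_rng P continuous_const continuous_id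

instance semidirectT2Space [T2Space G] : T2Space (G ⋊[autAction P] P) :=
  T2Space.of_injective_continuous
    (fun _ _ h => SemidirectProduct.ext (congrArg Prod.fst h) (congrArg Prod.snd h))
    continuous_induced_dom

instance semidirectIsTopologicalGroup [IsTopologicalGroup G] [CompactSpace G] [T2Space G] :
    IsTopologicalGroup (G ⋊[autAction P] P) where
  continuous_mul := by
    have hl := continuous_left P
    have hr := continuous_right P
    refine continuous_semidirect_rng P ?_ ?_
    · refine (hl.comp continuous_fst).mul (continuous_aut_eval.comp
        ((continuous_subtype_val.comp (hr.comp continuous_fst)).prodMk (hl.comp continuous_snd)))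
    · exact (hr.comp continuous_fst).mul (hr.comp continuous_snd)
  continuous_inv := by
    have hl := continuous_left P
    have hr := continuous_right P
    refine continuous_semidirect_rng P ?_ hr.inv
    exact continuous_aut_eval.comp ((continuous_subtype_val.comp hr.inv).prodMk hl.inv)

variable [IsTopologicalGroup G]

/-- The action of `G ⋊ P` on `G` by conjugation. -/
def conjAction (m : G ⋊[autAction P] P) : G ≃ₜ* G := conjHom G m.left * m.right

lemma inl_conjAction (m : G ⋊[autAction P] P) (x : G) :
    (SemidirectProduct.inl (conjAction P m x) : G ⋊[autAction P] P) =
      m * SemidirectProduct.inl x * m⁻¹ := by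
  obtain ⟨g, p⟩ := m
  have hp : ∀ y, autAction P p y = (p : G ≃ₜ* G) y := fun _ => rfl
  have hp' : ∀ y, (p : G ≃ₜ* G) ((autAction P p).symm y) = y :=
    fun y => aut_apply_inv_self (p : G ≃ₜ* G) y
  ext
  · simp [conjAction, aut_mul_apply, conjHom_apply, hp, hp']
  · simp

end Semidirect

/-! ### Coarser group topologies and the limit subgroup. -/

section Coarser

variable {G : Type*} [Group G] [TopologicalSpace G] {P : Subgroup (G ≃ₜ* G)}
  {K : Type*} [Group K] [TopologicalSpace K] [IsTopologicalGroup K] (e : G ⋊[autAction P] P ≃* K)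

/-- The elements of `G` whose image in `K` is a limit of images of elements of `P`. -/
def limitSubgroup : Subgroup G :=
  ((e.toMonoidHom.comp SemidirectProduct.inr).range.topologicalClosure).comap
    (e.toMonoidHom.comp SemidirectProduct.inl)

variable {e}

lemma mem_limitSubgroup_iff {g : G} : g ∈ limitSubgroup e ↔
    e (SemidirectProduct.inl g) ∈ closure (Set.range fun p : P => e (SemidirectProduct.inr p)) :=
  Iff.rfl

lemma isClosed_limitSubgroup (he : Continuous e) : IsClosed (limitSubgroup e : Set G) :=
  (Subgroup.isClosed_topologicalClosure _).preimage (he.comp (continuous_inl P))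

lemma isClosed_map_limitSubgroup [IsTopologicalGroup G] [CompactSpace G] [T2Space G]
    (he : Continuous e) :
    IsClosed ((limitSubgroup e).map (conjHom G) : Set (G ≃ₜ* G)) :=
  ((isClosed_limitSubgroup he).isCompact.image continuous_conjHom).isClosed

lemma apply_mem_limitSubgroup {g : G} (hg : g ∈ limitSubgroup e) (p : P) :
    (p : G ≃ₜ* G) g ∈ limitSubgroup e := by
  have hp : e (SemidirectProduct.inr p) ∈
      (e.toMonoidHom.comp SemidirectProduct.inr).range.topologicalClosure :=
    Subgroup.le_topologicalClosure _ ⟨p, rfl⟩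
  have key := SemidirectProduct.inl_aut (φ := autAction P) p g
  change e (SemidirectProduct.inl (autAction P p g)) ∈
    (e.toMonoidHom.comp SemidirectProduct.inr).range.topologicalClosure
  rw [key, map_mul, map_mul, map_inv, map_inv]
  exact mul_mem (mul_mem hp hg) (inv_mem hp)

/-- The condition on `q` is closed because the image of the limit subgroup is compact, so it need
only be checked on `P`. -/
lemma conj_mem_map_limitSubgroup [IsTopologicalGroup G] [CompactSpace G] [T2Space G]
    (he : Continuous e) {f q : G ≃ₜ* G}
    (hf : f ∈ (limitSubgroup e).map (conjHom G)) (hq : q ∈ P.topologicalClosure) :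
    q * f * q⁻¹ ∈ (limitSubgroup e).map (conjHom G) := by
  have hc : IsClosed {q : G ≃ₜ* G | q * f * q⁻¹ ∈ (limitSubgroup e).map (conjHom G)} :=
    (isClosed_map_limitSubgroup he).preimage
      ((continuous_id.mul continuous_const).mul continuous_inv)
  refine closure_minimal ?_ hc hq
  intro p hp
  obtain ⟨g, hg, rfl⟩ := hf
  exact ⟨p g, apply_mem_limitSubgroup hg ⟨p, hp⟩, (aut_mul_conjHom_mul_inv p g).symm⟩

variable [IsTopologicalGroup G] [CompactSpace G] [T2Space K]

/-- The conjugation action of `K` on the compact normal subgroup `G` is continuous. -/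
lemma continuous_conjAction_symm (he : Continuous e) :
    Continuous fun k => conjAction P (e.symm k) := by
  have hj : IsClosedEmbedding fun x : G => e (SemidirectProduct.inl x) :=
    (he.comp (continuous_inl P)).isClosedEmbedding
      (e.injective.comp SemidirectProduct.inl_injective)
  apply continuous_aut_of_uncurry
  -- After embedding `G` in `K`, the action becomes conjugation in `K`.
  rw [hj.isInducing.continuous_iff]
  have : ((fun x : G => e (SemidirectProduct.inl x)) ∘
      fun p : K × G => conjAction P (e.symm p.1) p.2) =
      fun p : K × G => p.1 * e (SemidirectProduct.inl p.2) * p.1⁻¹ := by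
    funext p
    simp [inl_conjAction]
  rw [this]
  exact (continuous_fst.mul (hj.continuous.comp continuous_snd)).mul continuous_fst.inv

/-- An element of the limit subgroup is the limit, in `K`, of elements of `P` which converge in
`Aut(G)` to the corresponding inner automorphism. -/
lemma exists_filter_of_mem_limitSubgroup (he : Continuous e) {g : G} (hg : g ∈ limitSubgroup e) :
    ∃ F : Filter P, F.NeBot ∧
      Tendsto (fun p => e (SemidirectProduct.inr p)) F (𝓝 (e (SemidirectProduct.inl g))) ∧
      Tendsto (fun p : P => (p : G ≃ₜ* G)) F (𝓝 (conjHom G g)) := by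
  let F : Filter P := comap (fun p => e (SemidirectProduct.inr p)) (𝓝 (e (SemidirectProduct.inl g)))
  have hF : Tendsto (fun p => e (SemidirectProduct.inr p)) F (𝓝 (e (SemidirectProduct.inl g))) :=
    tendsto_comap
  refine ⟨F, comap_neBot_iff_frequently.2 (by
    rw [frequently_iff]; intro U hU; exact (mem_closure_iff_nhds.1 hg U hU)), hF, ?_⟩
  convert ((continuous_conjAction_symm he).tendsto _).comp hF using 1
  · funext p
    simp [conjAction]
  · simp [conjAction]

/-- The approximating elements of `P` would converge in `K` both to `g` and to the element `conjHom
G g` of `P`. As `K` is Hausdorff, `g` then lies in both factors. -/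
lemma eq_one_of_mem_limitSubgroup (he : Continuous e) {g : G} (hg : g ∈ limitSubgroup e)
    (hP : conjHom G g ∈ P) : g = 1 := by
  obtain ⟨F, hF, h₁, h₂⟩ := exists_filter_of_mem_limitSubgroup he hg
  have h₃ : Tendsto id F (𝓝 (⟨conjHom G g, hP⟩ : P)) := tendsto_subtype_rng.2 h₂
  have h₄ := ((he.comp (continuous_inr P)).tendsto _).comp h₃
  have h₅ := e.injective (tendsto_nhds_unique h₁ h₄)
  simpa using congrArg SemidirectProduct.left h₅

variable [T2Space G]

lemma conjHom_mem_closure (he : Continuous e) {g : G} (hg : g ∈ limitSubgroup e) :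
    conjHom G g ∈ P.topologicalClosure := by
  obtain ⟨F, hF, -, h⟩ := exists_filter_of_mem_limitSubgroup he hg
  exact mem_closure_of_tendsto h (Eventually.of_forall fun p => p.2)

/-- If the limit subgroup is central, the topology of `K` is that of `G ⋊ P`. -/
lemma continuous_symm_of_conjHom_eq_one (he : Continuous e)
    (h : ∀ g ∈ limitSubgroup e, conjHom G g = 1) : Continuous e.symm := by
  let r : K →* P := (SemidirectProduct.rightHom).comp e.symm.toMonoidHom
  have hr : Continuous r := by
    refine continuous_of_continuousAt_one r ?_
    rw [ContinuousAt, map_one, tendsto_iff_ultrafilter]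
    intro F hF
    let l : K → G := fun k => (e.symm k).left
    obtain ⟨g, -, hg⟩ := isCompact_univ.ultrafilter_le_nhds (F.map l) (by simp)
    have hg : Tendsto l F (𝓝 g) := hg
    have hj := (((he.comp (continuous_inl P)).tendsto g).comp hg).inv.mul hF
    -- Along `F`, the `P`-coordinate `l(k)⁻¹ * k` tends in `K` to `g⁻¹`.
    have hmem : g⁻¹ ∈ limitSubgroup e := by
      rw [mem_limitSubgroup_iff]
      have : e (SemidirectProduct.inl g⁻¹) = (e (SemidirectProduct.inl g))⁻¹ * 1 := by simp
      rw [this]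
      refine mem_closure_of_tendsto hj (Eventually.of_forall fun k => ⟨r k, ?_⟩)
      apply e.symm.injective
      change _ = e.symm ((e (SemidirectProduct.inl (l k)))⁻¹ * k)
      rw [map_mul, map_inv, e.symm_apply_apply, e.symm_apply_apply, eq_inv_mul_iff_mul_eq]
      exact SemidirectProduct.inl_left_mul_inr_right _
    have hc : Tendsto (fun k => conjHom G (l k)) F (𝓝 1) := by
      have hone : conjHom G g = 1 := by
        have := h _ hmem
        rwa [map_inv, inv_eq_one] at this
      rw [← hone]
      exact (continuous_conjHom.tendsto g).comp hg
    have hπ := ((continuous_conjAction_symm he).tendsto 1).comp hF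
    -- As an automorphism, `r k` is the action of `k` with the inner part `conjHom G (l k)` removed;
    -- both tend to `1`.
    have hlim := hc.inv.mul hπ
    rw [nhds_subtype_eq_comap, tendsto_comap_iff]
    convert hlim using 1
    · funext k
      change _ = (conjHom G (l k))⁻¹ * (conjHom G (l k) * (r k : G ≃ₜ* G))
      simp
    · simp [conjAction]
  have hl : Continuous fun k => e (SemidirectProduct.inl (e.symm k).left) := by
    have : (fun k => e (SemidirectProduct.inl (e.symm k).left)) =
        fun k => k * (e (SemidirectProduct.inr (r k)))⁻¹ := by
      funext k
      apply e.symm.injective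
      rw [map_mul, map_inv, e.symm_apply_apply, e.symm_apply_apply, eq_mul_inv_iff_mul_eq]
      exact SemidirectProduct.inl_left_mul_inr_right _
    rw [this]
    exact continuous_id.mul (he.comp ((continuous_inr P).comp hr)).inv
  have hj : IsClosedEmbedding fun x : G => e (SemidirectProduct.inl x) :=
    (he.comp (continuous_inl P)).isClosedEmbedding
      (e.injective.comp SemidirectProduct.inl_injective)
  exact continuous_semidirect_rng P (hj.isInducing.continuous_iff.2 hl) hr

/-- If a subgroup `H` of `closure P` containing all inner automorphisms in `closure P` has an
essential subgroup contained in `P`, then the limit subgroup acts trivially on `G`. -/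
lemma conjHom_eq_one_of_isEssential (he : Continuous e) {Q H : Subgroup (G ≃ₜ* G)}
    (hQ : Q ≤ P) (hH : H ≤ P.topologicalClosure) (hI : P.topologicalClosure ⊓ Inn G ≤ H)
    (hess : IsEssential (Q.subgroupOf H)) {g : G} (hg : g ∈ limitSubgroup e) :
    conjHom G g = 1 := by
  by_contra hne
  let N : Subgroup H := ((limitSubgroup e).map (conjHom G)).subgroupOf H
  have hgH : conjHom G g ∈ H := hI ⟨conjHom_mem_closure he hg, g, rfl⟩
  have hnormal : N.Normal := ⟨fun f hf q => conj_mem_map_limitSubgroup he hf (hH q.2)⟩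
  have hclosed : IsClosed (N : Set H) :=
    (isClosed_map_limitSubgroup he).preimage continuous_subtype_val
  have hbot : N ≠ ⊥ := by
    intro hN
    have : (⟨conjHom G g, hgH⟩ : H) ∈ N := ⟨g, hg, rfl⟩
    rw [hN, Subgroup.mem_bot] at this
    exact hne (congrArg Subtype.val this)
  refine hess N hnormal hclosed hbot ((Subgroup.eq_bot_iff_forall _).2 ?_)
  rintro ⟨f, hfH⟩ ⟨hfQ, a, ha, hfa⟩
  have hfa : conjHom G a = f := hfa
  have haP : conjHom G a ∈ P := by rw [hfa]; exact hQ hfQ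
  have := eq_one_of_mem_limitSubgroup he ha haP
  subst this
  exact Subtype.ext (hfa.symm.trans (map_one _))

end Coarser

/-! ### Minimality criteria. -/

section Minimal

variable {G : Type*} [Group G] [TopologicalSpace G] [IsTopologicalGroup G] [CompactSpace G]
  [T2Space G] (P : Subgroup (G ≃ₜ* G))

lemma isMinimalGroup_of_conjHom_eq_one
    (h : ∀ (t : TopologicalSpace (G ⋊[autAction P] P)) (ht : @IsTopologicalGroup _ t _),
      @T2Space _ t → semidirectTopology (autAction P) ≤ t →
      ∀ g ∈ @limitSubgroup G _ _ P (G ⋊[autAction P] P) _ t ht (MulEquiv.refl _),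
        conjHom G g = 1) :
    IsMinimalGroup (G ⋊[autAction P] P) where
  isTopologicalGroup := inferInstance
  t2Space := inferInstance
  eq_of_coarser t ht₁ ht₂ hle :=
    le_antisymm
      (continuous_id_iff_le.1 (@continuous_symm_of_conjHom_eq_one G _ _ P _ _ t ht₁
        (MulEquiv.refl _) _ _ ht₂ _ (continuous_id_iff_le.2 hle) (h t ht₁ ht₂ hle)))
      hle

/-- The pair `Q`, `H` treats two cases at once: `P` in its closure, and the intersections of both
with `Inn G`. -/
lemma isMinimalGroup_of_isEssential {Q H : Subgroup (G ≃ₜ* G)}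
    (hQ : Q ≤ P) (hH : H ≤ P.topologicalClosure) (hI : P.topologicalClosure ⊓ Inn G ≤ H)
    (hess : IsEssential (Q.subgroupOf H)) : IsMinimalGroup (G ⋊[autAction P] P) :=
  isMinimalGroup_of_conjHom_eq_one P fun t ht₁ ht₂ hle _ hg =>
    @conjHom_eq_one_of_isEssential G _ _ P _ _ t ht₁ (MulEquiv.refl _) _ _ ht₂ _
      (continuous_id_iff_le.2 hle) Q H hQ hH hI hess _ hg

lemma isMinimalGroup_of_commutative (hG : ∀ a b : G, a * b = b * a) :
    IsMinimalGroup (G ⋊[autAction P] P) :=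
  isMinimalGroup_of_conjHom_eq_one P fun _ _ _ _ g _ => by
    ext x
    rw [conjHom_apply, hG g x, mul_inv_cancel_right]
    rfl

end Minimal

lemma isEssential_of_isClosed {G : Type*} [Group G] [TopologicalSpace G] [CompactSpace G]
    [T2Space G] (P : Subgroup (G ≃ₜ* G)) (hP : IsClosed (P : Set (G ≃ₜ* G))) :
    IsEssential (P.subgroupOf P.topologicalClosure) := by
  have h : P.subgroupOf P.topologicalClosure = ⊤ :=
    Subgroup.subgroupOf_eq_top.2 (Subgroup.topologicalClosure_minimal P le_rfl hP)
  intro N _ _ hN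
  rwa [h, top_inf_eq]

end MinimalSemidirect

open MinimalSemidirect

theorem mainTheorem3 {G : Type*} [Group G] [TopologicalSpace G] [IsTopologicalGroup G]
    [CompactSpace G] [T2Space G] (P : Subgroup (G ≃ₜ* G)) :
    ((∀ a b : G, a * b = b * a) →
      MinimalSemidirect.IsMinimalGroup (G ⋊[MinimalSemidirect.autAction P] P)) ∧
    (MinimalSemidirect.IsEssential (P.subgroupOf P.topologicalClosure) →
      MinimalSemidirect.IsMinimalGroup (G ⋊[MinimalSemidirect.autAction P] P)) ∧
    (IsClosed (P : Set (G ≃ₜ* G)) →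
      MinimalSemidirect.IsEssential (P.subgroupOf P.topologicalClosure) ∧
      MinimalSemidirect.IsMinimalGroup (G ⋊[MinimalSemidirect.autAction P] P)) ∧
    (MinimalSemidirect.IsEssential
        ((P ⊓ MinimalSemidirect.Inn G).subgroupOf
          (P.topologicalClosure ⊓ MinimalSemidirect.Inn G)) →
      MinimalSemidirect.IsMinimalGroup (G ⋊[MinimalSemidirect.autAction P] P)) := by
  have h₂ : IsEssential (P.subgroupOf P.topologicalClosure) →
      IsMinimalGroup (G ⋊[autAction P] P) :=
    isMinimalGroup_of_isEssential P le_rfl le_rfl inf_le_left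
  exact ⟨isMinimalGroup_of_commutative P, h₂,
    fun h => ⟨isEssential_of_isClosed P h, h₂ (isEssential_of_isClosed P h)⟩,
    isMinimalGroup_of_isEssential P inf_le_left inf_le_left le_rfl⟩
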